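/- Let $K$ be a commutative ring and ${\mathcal A}$ an associative unital $K$-algebra with a Rota–Baxter operator $P_+$ of weight $-1$, i.e. a $K$-linear map with $P_+(u)P_+(v)=P_+(P_+(u)v+uP_+(v)-uv)$; put $P_-=\mathrm{id}-P_+$ and ${\mathcal A}_\pm=P_\pm({\mathcal A})$. (For instance ${\mathcal A}={\mathcal A}_+\oplus{\mathcal A}_-$ with two subalgebras ${\mathcal A}_\pm$ and $P_\pm$ the projectors.) Let ${\bf Sym}=K\langle S_1,S_2,\dots\rangle$ be the algebra of noncommutative symmetric functions, graded by $\deg S_n=n$, with $S_0=1$; let $\Lambda_n$ be defined by $\Lambda_0=1$, $\sum_{i=0}^n(-1)^i\Lambda_iS_{n-i}=0$ $(n\ge1)$. For a composition $I=(i_1,\dots,i_r)$ of $|I|=n$, put $l(I)=r$, $D(I)=\{i_1,i_1+i_2,\dots,i_1+\dots+i_{r-1}\}$, $S^I=S_{i_1}\cdots S_{i_r}$, $\Lambda^I=\Lambda_{i_1}\cdots\Lambda_{i_r}$, and $R_I=\sum_{D(J)\subseteq D(I)}(-1)^{l(I)-l(J)}S^J$, the sum being over compositions $J$ of $n$. For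 $\varepsilon\in\{+,-\}^{n-1}$, $n\ge1$, put $R_{\varepsilon\bullet}=(-1)^{l(I)-1}R_I$, where $I$ is the composition of $n$ with $D(I)=\{i:\varepsilon_i=-\}$; write ${\mathcal E}=\bigcup_{n\ge1}\{+,-\}^{n-1}$. Let $a\in{\mathcal A}$ and $\sigma_a=\sum_{n\ge0}a^nS_n$, a series in the degree completion of ${\mathcal A}\otimes{\bf Sym}$. Its Birkhoff factors $\sigma_a^\pm=\sum_{n\ge 0}\sigma^\pm_n$ (with $\sigma^\pm_n$ of degree $n$) are defined by the Birkhoff recurrence: $\sigma_0^\pm=1$ and, for $n\ge1$, $$\sigma^-_n=-P_-\Big(\sum_{k=0}^{n-1}\sigma^-_k\,a^{n-k}S_{n-k}\Big),\qquad \sigma^+_n=P_+\Big(\sum_{k=0}^{n-1}\sigma^-_k\,a^{n-k}S_{n-k}\Big),$$ with $P_\pm$ acting on coefficients. For a composition $I=(i_1,\dots,i_n)$ and $\varepsilon\in\{+,-\}^n$ let $P^I_\varepsilon(a)=P_{\varepsilon_n}\big(P^{I'}_{\varepsilon'}(a)\,a^{i_n}\big)$, where $I',\varepsilon'$ are obtained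 by deleting the last entries, and $P^\emptyset_\emptyset(a)=1$; let $P_\varepsilon(a)=P^{(1,\dots,1)}_\varepsilon(a)$. (1) $\sigma_a^+=\sigma_a^-\sigma_a$, the series $\sigma_a^\pm$ have constant term $1$, and the component of $\sigma_a^\pm$ of each degree $n\geq1$ is in ${\mathcal A}_\pm\otimes{\bf Sym}$ (more precisely, in the image of $P_\pm\otimes\mathrm{id}$). If $P_+$ is idempotent, $(\sigma_a^+,\sigma_a^-)$ is the only pair of series with these properties. (2) With $I$ running over all nonempty compositions, $$\sigma_a^+=1+\sum_I(-1)^{l(I)-1}P^I_{(-)^{l(I)-1},+}(a)\,S^I=1+\sum_I(-1)^{|I|+l(I)}P^I_{(+)^{l(I)}}(a)\,\Lambda^I=1+\sum_{\varepsilon\in{\mathcal E}}P_{\varepsilon,+}(a)\,R_{\varepsilon\bullet},$$ $$\sigma_a^-=1+\sum_I(-1)^{l(I)}P^I_{(-)^{l(I)}}(a)\,S^I=1+\sum_I(-1)^{|I|+l(I)-1}P^I_{(+)^{l(I)-1},-}(a)\,\Lambda^I=1-\sum_{\varepsilon\in{\mathcal E}}P_{\varepsilon,-}(a)\,R_{\varepsilon\bullet}.$$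 (3) Consider the algebra of sequences of polynomials in $x_1,x_2,\dots$ over $K$ with pointwise operations, with $R({\bf z})=(0,z_1,z_1+z_2,\dots)$, $V({\bf z})=(z_2,z_3,\dots)$ and $P_+=-R$, and let ${\bf x}=(x_1,x_2,\dots)$. Let $\mathfrak A({\bf x})$ be the smallest non-unital subalgebra containing ${\bf x}$ and stable under $R$ (the free commutative Rota–Baxter algebra on one generator). For a quasi-symmetric function $f$ put $\tilde f=(f(0),f(x_1),f(x_1,x_2),\dots)$; let $M_I$ be the monomial quasi-symmetric functions, $M_I(-X)=(-1)^{l(I)}\sum_{D(J)\subseteq D(I)}M_J$ and $F_I=\sum_{D(J)\supseteq D(I)}M_J$, the sums being over compositions $J$ of $|I|$, and let $\bar I^\sim$ be the composition of $|I|$ with $D(\bar I^\sim)=\{1,\dots,|I|-1\}\setminus D(I)$. Then for every nonempty composition $I$ all $P^I_\varepsilon({\bf x})$ lie in $\mathfrak A({\bf x})$; the coefficients of $S^I$ in the above expansions of $\sigma_{\bf x}^+$ and $\sigma_{\bf x}^-$ are $$(-1)^{l(I)-1}P^I_{(-)^{l(I)-1},+}({\bf x})=\widetilde{M_I(-X)},\qquad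 (-1)^{l(I)}P^I_{(-)^{l(I)}}({\bf x})=V\,\widetilde{M_I(-X)};$$ and, with $D(I)=\{i:\varepsilon_i=-\}$, the coefficients of $R_I$ are $$(-1)^{l(I)-1}P_{\varepsilon,+}({\bf x})=(-1)^{|I|}\tilde F_{\bar I^\sim},\qquad -(-1)^{l(I)-1}P_{\varepsilon,-}({\bf x})=V\big((-1)^{|I|}\tilde F_{\bar I^\sim}\big).$$ -/

import Mathlib

open scoped TensorProduct

/-! ### Rota-Baxter algebras and iterated projections -/

/-- A Rota-Baxter operator `P₊` of weight `-1` on the (associative, unital) `K`-algebra `A`.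
When `P₊` is idempotent this is the same as a decomposition `A = A₊ ⊕ A₋` into two subalgebras,
`P₊` being the projection onto `A₊` along `A₋`. -/
structure RotaBaxter (K A : Type*) [CommRing K] [Ring A] [Algebra K A] where
  plus : A →ₗ[K] A
  rota_baxter : ∀ u v : A, plus u * plus v = plus (plus u * v + u * plus v - u * v)

namespace RotaBaxter

variable {K A : Type*} [CommRing K] [Ring A] [Algebra K A]

/-- `P₋ = id - P₊`. -/
def minus (P : RotaBaxter K A) : A →ₗ[K] A := LinearMap.id - P.plus

/-- `P_ε` for a sign `ε`; here and everywhere below `true` is the sign `+`, `false` the sign `-`. -/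
def proj (P : RotaBaxter K A) : Bool → (A →ₗ[K] A)
  | true => P.plus
  | false => P.minus

/-- `P^I_ε(a) = P_{ε_n}(P^{I'}_{ε'}(a) a^{i_n})`, where `I'`, `ε'` are `I`, `ε` without their last
entries, and `P^∅_∅(a) = 1`. Only used when `I` and `ε` have the same length. -/
def iter (P : RotaBaxter K A) (a : A) (I : List ℕ) (ε : List Bool) : A :=
  (I.zip ε).foldl (fun u p => P.proj p.2 (u * a ^ p.1)) 1

end RotaBaxter

/-! ### Compositions -/

/-- `D(I) = {i₁, i₁ + i₂, …, i₁ + ⋯ + i_{r-1}}`. -/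
def descents {n : ℕ} (I : Composition n) : Finset ℕ :=
  (Finset.Ioo 0 I.length).image I.sizeUpTo

/-- The composition `I` of `m + 1` with `D(I) = {i ∈ {1, …, m} ; ε_i = -}`
(see `descents_compOfSigns`). -/
def compOfSigns {m : ℕ} (ε : Fin m → Bool) : Composition (m + 1) :=
  ((compositionAsSetEquiv (m + 1)).symm
    (Finset.univ.filter fun i : Fin m => ε i = false)).toComposition

theorem mem_descents_iff {n : ℕ} (I : Composition n) (k : ℕ) :
    k ∈ descents I ↔ ∃ h : k < n, 0 < k ∧ (⟨k, by omega⟩ : Fin (n + 1)) ∈ I.boundaries := by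
  simp only [descents, Finset.mem_image, Finset.mem_Ioo, Composition.boundaries, Finset.mem_map,
    Finset.mem_univ, true_and]
  constructor
  · rintro ⟨j, ⟨hj0, hj⟩, rfl⟩
    have h1 : I.sizeUpTo j < n :=
      (I.sizeUpTo_strict_mono hj).trans_le (I.sizeUpTo_le _)
    have h2 : 0 < I.sizeUpTo j := by
      have h3 := I.sizeUpTo_strict_mono (i := 0) (by omega)
      have h4 := I.monotone_sizeUpTo (show 0 + 1 ≤ j by omega)
      omega
    exact ⟨h1, h2, ⟨j, by omega⟩, rfl⟩
  · rintro ⟨h, hk, ⟨j, hj⟩, he⟩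
    have he' : I.sizeUpTo j = k := congrArg Fin.val he
    refine ⟨j, ⟨?_, ?_⟩, he'⟩
    · rcases Nat.eq_zero_or_pos j with rfl | h0
      · simp at he'; omega
      · exact h0
    · by_contra hlt
      have : I.sizeUpTo j = n := I.sizeUpTo_ofLength_le j (by omega)
      omega

theorem descents_compOfSigns {m : ℕ} (ε : Fin m → Bool) :
    descents (compOfSigns ε) =
      (Finset.univ.filter fun i : Fin m => ε i = false).image fun i : Fin m => (i : ℕ) + 1 := by
  ext k
  rw [mem_descents_iff, compOfSigns, CompositionAsSet.toComposition_boundaries]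
  simp only [compositionAsSetEquiv, Equiv.coe_fn_symm_mk, Set.toFinset_ofPred, Finset.mem_filter,
    Finset.mem_univ, true_and, Finset.mem_image, Fin.ext_iff, Fin.val_last, Fin.val_zero]
  constructor
  · rintro ⟨h, h0, h1 | h1 | ⟨j, hj, h1⟩⟩
    · omega
    · omega
    · exact ⟨j, hj, h1.symm⟩
  · rintro ⟨j, hj, rfl⟩
    have := j.2
    exact ⟨by omega, by omega, Or.inr (Or.inr ⟨j, hj, rfl⟩)⟩

/-! ### Noncommutative symmetric functions -/

/-- `Sym`: the free associative algebra on `S₁, S₂, …`. -/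
abbrev NSym (K : Type*) [CommRing K] := FreeAlgebra K ℕ+

namespace NSym

variable (K : Type*) [CommRing K]

/-- The complete functions `S_n`, with `S₀ = 1`. -/
noncomputable def S (n : ℕ) : NSym K :=
  if h : 0 < n then FreeAlgebra.ι K ⟨n, h⟩ else 1

/-- The elementary functions `Λ_n`: `Λ₀ = 1` and `∑_{i ≤ n} (-1)^i Λ_i S_{n-i} = 0` for `n ≥ 1`. -/
noncomputable def Lam : ℕ → NSym K
  | 0 => 1
  | n + 1 => ∑ i : Fin (n + 1), (-1) ^ (n - (i : ℕ)) * Lam (i : ℕ) * S K (n + 1 - (i : ℕ))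

/-- `S^I = S_{i₁} ⋯ S_{i_r}`. -/
noncomputable def SProd {n : ℕ} (I : Composition n) : NSym K := (I.blocks.map (S K)).prod

/-- `Λ^I = Λ_{i₁} ⋯ Λ_{i_r}`. -/
noncomputable def LamProd {n : ℕ} (I : Composition n) : NSym K := (I.blocks.map (Lam K)).prod

/-- The ribbon Schur functions `R_I = ∑ (-1)^{l(I) - l(J)} S^J`, the sum being over the `J` that are
coarser than (or equal to) `I`. -/
noncomputable def ribbon {n : ℕ} (I : Composition n) : NSym K :=
  ∑ J : Composition n with descents J ⊆ descents I, (-1) ^ (I.length - J.length) * SProd K J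

/-- The signed ribbon `R_{ε•} = (-1)^{l(I) - 1} R_I`, where `D(I) = {i ; ε_i = -}`. -/
noncomputable def signedRibbon {m : ℕ} (ε : Fin m → Bool) : NSym K :=
  (-1) ^ ((compOfSigns ε).length - 1) * ribbon K (compOfSigns ε)

end NSym

/-! ### The Birkhoff factors of `σ_a`

Series with coefficients in `A ⊗ Sym` are written as power series in a variable which records the
degree: the coefficient of index `n` is the component in `A ⊗ Sym_n`. -/

namespace RotaBaxter

variable {K A : Type*} [CommRing K] [Ring A] [Algebra K A]

/-- `σ_a = ∑_n aⁿ S_n`. -/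
noncomputable def sigma (K : Type*) {A : Type*} [CommRing K] [Ring A] [Algebra K A] (a : A) :
    PowerSeries (A ⊗[K] NSym K) :=
  PowerSeries.mk fun n => (a ^ n) ⊗ₜ[K] NSym.S K n

/-- `P_±` acting on the coefficients: `P_± ⊗ id` on `A ⊗ Sym`. -/
noncomputable def projSym (P : RotaBaxter K A) (ε : Bool) :
    A ⊗[K] NSym K →ₗ[K] A ⊗[K] NSym K :=
  (P.proj ε).rTensor (NSym K)

/-- Components of `σ_a⁻`, by the Birkhoff recurrence
`φ⁻(x) = -P₋(φ(x) + ∑ φ⁻(x') φ(x''))` (sum over the reduced coproduct), that is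
`σ⁻_n = -P₋(σ_n + ∑_{0 < k < n} σ⁻_k σ_{n-k})`; the first summand is written as the term `k = 0`. -/
noncomputable def birkhoffMinusCoeff (P : RotaBaxter K A) (a : A) : ℕ → A ⊗[K] NSym K
  | 0 => 1
  | n + 1 => -P.projSym false (∑ k : Fin (n + 1), birkhoffMinusCoeff P a (k : ℕ) *
      (sigma K a).coeff (n + 1 - (k : ℕ)))

/-- Components of `σ_a⁺`, by the Birkhoff recurrence `φ⁺(x) = P₊(φ(x) + ∑ φ⁻(x') φ(x''))`. -/
noncomputable def birkhoffPlusCoeff (P : RotaBaxter K A) (a : A) : ℕ → A ⊗[K] NSym K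
  | 0 => 1
  | n + 1 => P.projSym true (∑ k : Fin (n + 1), P.birkhoffMinusCoeff a (k : ℕ) *
      (sigma K a).coeff (n + 1 - (k : ℕ)))

/-- `σ_a⁺`. -/
noncomputable def sigmaPlus (P : RotaBaxter K A) (a : A) : PowerSeries (A ⊗[K] NSym K) :=
  PowerSeries.mk (P.birkhoffPlusCoeff a)

/-- `σ_a⁻`. -/
noncomputable def sigmaMinus (P : RotaBaxter K A) (a : A) : PowerSeries (A ⊗[K] NSym K) :=
  PowerSeries.mk (P.birkhoffMinusCoeff a)

/-- `(f, g)` is a Birkhoff factorisation `f = g σ_a`: both series start with `1`, and apart from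
that `f` has its coefficients in `A₊ = P₊(A)` and `g` has its coefficients in `A₋ = P₋(A)`. -/
structure IsBirkhoffFactorization (P : RotaBaxter K A) (a : A)
    (f g : PowerSeries (A ⊗[K] NSym K)) : Prop where
  factor : f = g * sigma K a
  coeff_zero_plus : f.coeff 0 = 1
  coeff_zero_minus : g.coeff 0 = 1
  coeff_plus : ∀ n, 0 < n → f.coeff n ∈ LinearMap.range (P.projSym true)
  coeff_minus : ∀ n, 0 < n → g.coeff n ∈ LinearMap.range (P.projSym false)

end RotaBaxter

/-! ### The Rota-Baxter algebra of sequences of polynomials -/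

/-- Sequences of polynomials, with pointwise operations. The variables `x₁, x₂, …` are numbered
`X 0, X 1, …`, and the first term of a sequence has index `0`. -/
abbrev PolySeq (K : Type*) [CommRing K] := ℕ → MvPolynomial ℕ K

namespace PolySeq

/-- The sequence `(x₁, x₂, x₃, …)`. -/
noncomputable def x (K : Type*) [CommRing K] : PolySeq K := fun n => MvPolynomial.X n

/-- `R(z) = (0, z₁, z₁ + z₂, …)`. -/
noncomputable def R (K : Type*) [CommRing K] : PolySeq K →ₗ[K] PolySeq K where
  toFun z := fun n => ∑ k ∈ Finset.range n, z k
  map_add' z w := by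
    funext n
    simp [Finset.sum_add_distrib]
  map_smul' c z := by
    funext n
    simp [Finset.smul_sum]

/-- The shift `V(z) = (z₂, z₃, …)`. -/
def V {K : Type*} [CommRing K] (z : PolySeq K) : PolySeq K := fun n => z (n + 1)

/-- The Rota-Baxter structure of weight `-1` with `P₊ = -R`. -/
noncomputable def rotaBaxter (K : Type*) [CommRing K] : RotaBaxter K (PolySeq K) where
  plus := -R K
  rota_baxter u v := by
    funext n
    simp only [R, LinearMap.neg_apply, LinearMap.coe_mk, AddHom.coe_mk, Pi.mul_apply, Pi.neg_apply,
      Pi.add_apply, Pi.sub_apply]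
    induction n with
    | zero => simp
    | succ n ih =>
      simp only [Finset.sum_range_succ]
      linear_combination ih

/-- The (non-unital) Rota-Baxter subalgebra of the algebra of sequences generated by `x`, which is
the free commutative Rota-Baxter algebra on one generator. -/
noncomputable def freeRotaBaxter (K : Type*) [CommRing K] : NonUnitalSubalgebra K (PolySeq K) :=
  sInf {B | x K ∈ B ∧ ∀ z ∈ B, R K z ∈ B}

open Classical in
/-- The sequence of the `M_I(x₁, …, x_n)`, `n = 0, 1, 2, …`, for the monomial quasi-symmetric function
`M_I = ∑_{j₁ < ⋯ < j_r} x_{j₁}^{i₁} ⋯ x_{j_r}^{i_r}`. -/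
noncomputable def monomialSeq (K : Type*) [CommRing K] {d : ℕ} (I : Composition d) : PolySeq K :=
  fun n => ∑ j : Fin I.length → Fin n with StrictMono j,
    ∏ k, MvPolynomial.X (j k : ℕ) ^ I.blocksFun k

/-- The sequence of the `M_I(-X)`, where `M_I(-X) = (-1)^{l(I)} ∑ M_J(X)`, the sum being over the `J`
that are coarser than (or equal to) `I`. -/
noncomputable def monomialNegSeq (K : Type*) [CommRing K] {d : ℕ} (I : Composition d) : PolySeq K :=
  (-1) ^ I.length * ∑ J : Composition d with descents J ⊆ descents I, monomialSeq K J

/-- The sequence of the `F_I(x₁, …, x_n)`, where `F_I = ∑ M_J`, the sum being over the `J` that are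
finer than (or equal to) `I`. -/
noncomputable def fundamentalSeq (K : Type*) [CommRing K] {d : ℕ} (I : Composition d) : PolySeq K :=
  ∑ J : Composition d with descents I ⊆ descents J, monomialSeq K J

end PolySeq

/-- The mirror image of the conjugate of `I = compOfSigns ε`: the composition whose descent set is
the complement of `D(I)`. -/
def conjMirror {m : ℕ} (ε : Fin m → Bool) : Composition (m + 1) :=
  compOfSigns fun i => !(ε i)

/-!
Write `X_n = ∑_{k < n} σ⁻_k aⁿ⁻ᵏ S_{n-k}`. Then `σ⁺_n - σ⁻_n = P₊ X_n + P₋ X_n = X_n`, which is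
the factorisation `σ⁺ = σ⁻ σ_a`. If `P₊` is idempotent, it fixes the image of `P₊` and kills that
of `P₋`, so that `P₊` applied to the coefficients of a factorisation `f = g σ_a` gives back the
recurrence (`IsBirkhoffFactorization.unique`).

The recurrence adds one part at the end of a composition, hence its solution is the sum over all
compositions of `(-1)^l P^I_{-⋯-}(a) S^I` (`eq_sum_of_recurrence`). Since
`σ⁻ = σ⁺ σ_a⁻¹ = σ⁺ ∑ (-a)ⁿ Λ_n`, the same `X_n` equals `-∑_{k < n} σ⁺_k (-a)ⁿ⁻ᵏ Λ_{n-k}`, so `σ⁺`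
satisfies the recurrence with `P₊` and `Λ` in the roles of `P₋` and `S`; this gives the expansion
on the `Λ^I`.

Everything else is multilinearity. Both `P^I_{q⋯q,s}(a)` and `P_{ε,s}(a)` are of the form
`P_s(T_m(⋯ T₁(a) a ⋯) a)`, a power of `a` with operators inserted between the factors
(`nestedPower`): in the first case `P_q` at the descents of `I` and the identity elsewhere, in the
second case `P_{ε_i}` at the place `i`. Expanding `id = P₊ + P₋` at the non-descents of `I`
expresses the coefficient of `S^I` through the `P_{ε,s}(a)`, and this turns the expansion on the
`S^I` into the one on ribbons. Expanding `P₋ = id - P₊` at the places where `P₋` is inserted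
expresses `P^I_{-⋯-,s}(a)` and `P_{ε,s}(a)` through the `P^J_{+⋯+,s}(a)`, with `J` coarser than
`I` in the first case, and with a descent at least wherever `ε` has the sign `+` in the second.
For sequences of polynomials `P₊ = -R`, and `(-1)^l P^J_{+⋯+}(x)` is the sequence of the monomial
quasi-symmetric function `M_J` (`monomialSeq_eq_iter`), so the two expansions are the definitions
of `M_I(-X)` and of the fundamental quasi-symmetric functions. The statements for the last sign
`-` follow from those for `+` by `V P₊ = -P₋`.
-/

/-! ### Compositions and their descent sets -/

theorem descents_subset {n : ℕ} (I : Composition n) : descents I ⊆ Finset.Ioo 0 n := by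
  intro k hk
  obtain ⟨h, h0, -⟩ := (mem_descents_iff I k).1 hk
  exact Finset.mem_Ioo.2 ⟨h0, h⟩

theorem descents_injective (n : ℕ) : Function.Injective (descents (n := n)) := by
  intro I J h
  apply (compositionEquiv n).injective
  change I.toCompositionAsSet = J.toCompositionAsSet
  ext k : 2
  rw [I.toCompositionAsSet_boundaries, J.toCompositionAsSet_boundaries]
  have key : ∀ I : Composition n,
      k ∈ I.boundaries ↔ k = 0 ∨ k = Fin.last n ∨ (k : ℕ) ∈ descents I := by
    intro I
    rw [mem_descents_iff]
    constructor
    · intro hk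
      by_cases h0 : k = 0
      · exact Or.inl h0
      by_cases h1 : k = Fin.last n
      · exact Or.inr (Or.inl h1)
      · refine Or.inr (Or.inr ⟨?_, ?_, hk⟩)
        · have := k.2
          have : (k : ℕ) ≠ n := fun h => h1 (Fin.ext h)
          omega
        · have : (k : ℕ) ≠ 0 := fun h => h0 (Fin.ext h)
          omega
    · rintro (rfl | rfl | ⟨_, _, hk⟩)
      · exact I.toCompositionAsSet.zero_mem
      · exact I.toCompositionAsSet.getLast_mem
      · exact hk
  rw [key, key, h]

theorem card_descents {n : ℕ} (I : Composition n) : (descents I).card = I.length - 1 := by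
  rw [descents, Finset.card_image_of_injOn, Nat.card_Ioo, Nat.sub_zero]
  have hmono : StrictMonoOn I.sizeUpTo (Set.Icc 0 I.length) :=
    strictMonoOn_of_lt_succ Set.ordConnected_Icc fun i _ _ hi => by
      have : i + 1 ≤ I.length := hi.2
      exact I.sizeUpTo_strict_mono (by omega)
  refine hmono.injOn.mono fun i hi => ?_
  have := Finset.mem_Ioo.1 (Finset.mem_coe.1 hi)
  exact ⟨by omega, by omega⟩

theorem mem_descents_compOfSigns {m : ℕ} (ε : Fin m → Bool) (i : Fin m) :
    (i : ℕ) + 1 ∈ descents (compOfSigns ε) ↔ ε i = false := by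
  rw [descents_compOfSigns, Finset.mem_image]
  constructor
  · rintro ⟨j, hj, hji⟩
    obtain rfl : j = i := Fin.ext (by omega)
    exact (Finset.mem_filter.1 hj).2
  · exact fun h => ⟨i, by simp [h], rfl⟩

theorem compOfSigns_injective (m : ℕ) : Function.Injective (compOfSigns (m := m)) := by
  intro ε δ h
  funext i
  have h1 := mem_descents_compOfSigns ε i
  rw [h, mem_descents_compOfSigns] at h1
  cases h2 : ε i <;> cases h3 : δ i <;> simp_all

/-- A composition of `m + 1` is the same thing as its descent set, an arbitrary subset of
`{1, …, m}`. -/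
theorem sum_composition_eq_sum_powerset {M : Type*} [AddCommMonoid M] (m : ℕ)
    (f : Finset ℕ → M) :
    ∑ I : Composition (m + 1), f (descents I) = ∑ D ∈ (Finset.Ioo 0 (m + 1)).powerset, f D := by
  have himage : Finset.univ.image (descents (n := m + 1)) = (Finset.Ioo 0 (m + 1)).powerset := by
    apply Finset.eq_of_subset_of_card_le
    · intro D hD
      obtain ⟨I, -, rfl⟩ := Finset.mem_image.1 hD
      exact Finset.mem_powerset.2 (descents_subset I)
    · rw [Finset.card_image_of_injective _ (descents_injective _), Finset.card_powerset,
        Finset.card_univ, composition_card, Nat.card_Ioo, Nat.sub_zero]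
  rw [← himage, Finset.sum_image fun _ _ _ _ h => descents_injective _ h]

/-- A composition of `m + 1` is the same thing as a word of `m` signs. -/
theorem sum_compOfSigns {M : Type*} [AddCommMonoid M] (m : ℕ) (f : Composition (m + 1) → M) :
    ∑ ε : Fin m → Bool, f (compOfSigns ε) = ∑ I : Composition (m + 1), f I := by
  refine Function.Bijective.sum_comp ?_ f
  rw [Fintype.bijective_iff_injective_and_card]
  refine ⟨compOfSigns_injective m, ?_⟩
  rw [composition_card]
  simp

theorem descents_conjMirror {m : ℕ} (ε : Fin m → Bool) :
    descents (conjMirror ε) = Finset.Ioo 0 (m + 1) \ descents (compOfSigns ε) := by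
  ext k
  rw [Finset.mem_sdiff, Finset.mem_Ioo]
  by_cases hk : 0 < k ∧ k < m + 1
  · obtain ⟨i, rfl⟩ : ∃ i : Fin m, k = i + 1 := ⟨⟨k - 1, by omega⟩, by simp; omega⟩
    rw [conjMirror, mem_descents_compOfSigns, mem_descents_compOfSigns]
    simp [hk]
  · simp only [hk, false_and, iff_false]
    exact fun h => hk (Finset.mem_Ioo.1 (descents_subset _ h))

/-- Splitting off the last part: a composition of `n + 1` is a composition of some `k ≤ n` followed
by the part `n + 1 - k`. -/
theorem sum_composition_succ {M : Type*} [AddCommMonoid M] (n : ℕ) (f : List ℕ → M) :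
    ∑ I : Composition (n + 1), f I.blocks =
      ∑ k : Fin (n + 1), ∑ J : Composition k, f (J.blocks ++ [n + 1 - (k : ℕ)]) := by
  let e : (Σ k : Fin (n + 1), Composition k) → Composition (n + 1) := fun q =>
    ⟨q.2.blocks ++ [n + 1 - (q.1 : ℕ)], fun {i} hi => by
      have := q.1.2
      rcases List.mem_append.1 hi with hi | hi
      · exact q.2.blocks_pos hi
      · rw [List.mem_singleton.1 hi]
        omega, by
      have := q.1.2
      rw [List.sum_append, q.2.blocks_sum, List.sum_singleton]
      omega⟩
  have he : Function.Bijective e := by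
    constructor
    · rintro ⟨k, J⟩ ⟨k', J'⟩ h
      have h1 : J.blocks ++ [n + 1 - (k : ℕ)] = J'.blocks ++ [n + 1 - (k' : ℕ)] :=
        congrArg Composition.blocks h
      obtain ⟨h2, -⟩ := List.append_inj' h1 rfl
      obtain rfl : k = k' := Fin.ext (by rw [← J.blocks_sum, ← J'.blocks_sum, h2])
      rw [Composition.ext h2]
    · intro I
      rcases List.eq_nil_or_concat' I.blocks with h | ⟨L, p, h⟩
      · exact absurd ((I.blocks_eq_nil).1 h) (by omega)
      · have hpos : ∀ {i}, i ∈ L ++ [p] → 0 < i := fun {i} hi => I.blocks_pos (h ▸ hi)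
        have hp : 0 < p := hpos (by simp)
        have hsum : L.sum + p = n + 1 := by
          have := I.blocks_sum
          rwa [h, List.sum_append, List.sum_singleton] at this
        refine ⟨⟨⟨L.sum, by omega⟩, ⟨L, fun hi => hpos (List.mem_append_left _ hi), rfl⟩⟩, ?_⟩
        apply Composition.ext
        change L ++ [n + 1 - L.sum] = I.blocks
        rw [h, show n + 1 - L.sum = p by omega]
  rw [← he.sum_comp fun I => f I.blocks, Fintype.sum_sigma]

/-! ### Powers with operators inserted -/

namespace RotaBaxter

variable {K A : Type*} [CommRing K] [Ring A] [Algebra K A]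

theorem iter_append_singleton (P : RotaBaxter K A) (a : A) {I : List ℕ} {ε : List Bool}
    (h : I.length = ε.length) (p : ℕ) (s : Bool) :
    P.iter a (I ++ [p]) (ε ++ [s]) = P.proj s (P.iter a I ε * a ^ p) := by
  simp [iter, List.zip_append h]

/-- The power `a ^ (m + 1)`, computed from the left, with the operator `T i` applied to the product
of the first `i` factors for `1 ≤ i ≤ m`: `T_m(⋯ T₂(T₁(a) a) a ⋯) a`. The other values of `T`, in
particular `T 0`, play no role. -/
def nestedPower (a : A) (T : ℕ → A →ₗ[K] A) : ℕ → A
  | 0 => a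
  | m + 1 => T (m + 1) (nestedPower a T m) * a

theorem nestedPower_congr (a : A) {T U : ℕ → A →ₗ[K] A} (m : ℕ)
    (h : ∀ i ∈ Finset.Ioo 0 (m + 1), T i = U i) : nestedPower a T m = nestedPower a U m := by
  induction m with
  | zero => rfl
  | succ m ih =>
    rw [nestedPower, nestedPower, h (m + 1) (by simp), ih fun i hi => h i ?_]
    rw [Finset.mem_Ioo] at hi ⊢
    omega

/-- Only the identity is inserted after the first `m + 1` factors. -/
theorem nestedPower_add (a : A) {T : ℕ → A →ₗ[K] A} (m p : ℕ)
    (h : ∀ i, m < i → i < m + p + 1 → T i = LinearMap.id) :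
    nestedPower a T (m + p) = nestedPower a T m * a ^ p := by
  induction p with
  | zero => simp
  | succ p ih =>
    rw [← Nat.add_assoc, nestedPower, h (m + p + 1) (by omega) (by omega), LinearMap.id_apply,
      ih fun i h1 h2 => h i h1 (by omega), mul_assoc, pow_succ]

theorem nestedPower_eq_zero (a : A) {T : ℕ → A →ₗ[K] A} {m i : ℕ}
    (hi : i ∈ Finset.Ioo 0 (m + 1)) (h : T i = 0) : nestedPower a T m = 0 := by
  induction m with
  | zero =>
    rw [Finset.mem_Ioo] at hi
    omega
  | succ m ih =>
    rw [nestedPower]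
    by_cases him : i = m + 1
    · rw [← him, h, LinearMap.zero_apply, zero_mul]
    · rw [ih, map_zero, zero_mul]
      rw [Finset.mem_Ioo] at hi ⊢
      omega

theorem Ioo_succ_eq_insert (m : ℕ) :
    Finset.Ioo 0 (m + 1 + 1) = insert (m + 1) (Finset.Ioo 0 (m + 1)) := by
  ext i
  rw [Finset.mem_insert, Finset.mem_Ioo, Finset.mem_Ioo]
  omega

theorem nestedPower_smul (a : A) (c : ℕ → K) (T : ℕ → A →ₗ[K] A) (m : ℕ) :
    nestedPower a (fun i => c i • T i) m =
      (∏ i ∈ Finset.Ioo 0 (m + 1), c i) • nestedPower a T m := by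
  induction m with
  | zero => simp [nestedPower, show Finset.Ioo 0 1 = ∅ from rfl]
  | succ m ih =>
    rw [nestedPower, ih, nestedPower, LinearMap.smul_apply, map_smul, smul_mul_assoc,
      smul_mul_assoc, smul_smul,
      Ioo_succ_eq_insert m,
      Finset.prod_insert (by simp)]

/-- `nestedPower` is multilinear in the inserted operators. -/
theorem nestedPower_add_eq_sum (a : A) (U W : ℕ → A →ₗ[K] A) (m : ℕ) :
    nestedPower a (U + W) m =
      ∑ D ∈ (Finset.Ioo 0 (m + 1)).powerset, nestedPower a (D.piecewise U W) m := by
  induction m with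
  | zero => simp [nestedPower]
  | succ m ih =>
    rw [Ioo_succ_eq_insert m,
      Finset.sum_powerset_insert (by simp), nestedPower, ih, Pi.add_apply, LinearMap.add_apply,
      add_mul, add_comm, map_sum, map_sum, Finset.sum_mul, Finset.sum_mul]
    congr 1 <;> refine Finset.sum_congr rfl fun D hD => ?_
    · have hm : m + 1 ∉ D := fun h => by simpa using Finset.mem_powerset.1 hD h
      rw [nestedPower, Finset.piecewise_eq_of_notMem _ _ _ hm]
    · rw [nestedPower, Finset.piecewise_eq_of_mem _ _ _ (Finset.mem_insert_self _ _)]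
      congr 2
      refine nestedPower_congr a m fun i hi => ?_
      rw [Finset.piecewise_insert_of_ne]
      rw [Finset.mem_Ioo] at hi
      omega

/-- Multilinearity of `nestedPower` when the operator to insert is `U i` on `L`, `W i` outside `H`
and `U i + W i` on the rest. -/
theorem nestedPower_eq_sum_between (a : A) {T : ℕ → A →ₗ[K] A} (U W : ℕ → A →ₗ[K] A) (m : ℕ)
    {L H : Finset ℕ} (hLH : L ⊆ H) (hL : L ⊆ Finset.Ioo 0 (m + 1)) (hTL : ∀ i ∈ L, T i = U i)
    (hTH : ∀ i ∈ Finset.Ioo 0 (m + 1), i ∉ H → T i = W i)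
    (hT : ∀ i ∈ Finset.Ioo 0 (m + 1), i ∉ L → i ∈ H → T i = U i + W i) :
    nestedPower a T m = ∑ D ∈ (Finset.Ioo 0 (m + 1)).powerset,
      if L ⊆ D ∧ D ⊆ H then nestedPower a (D.piecewise U W) m else 0 := by
  rw [nestedPower_congr a m (U := H.piecewise U 0 + L.piecewise 0 W), nestedPower_add_eq_sum]
  · refine Finset.sum_congr rfl fun D hD => ?_
    have hD := Finset.mem_powerset.1 hD
    split_ifs with h
    · refine nestedPower_congr a m fun i _ => ?_
      by_cases hi : i ∈ D
      · simp [hi, h.2 hi]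
      · have : i ∉ L := fun h' => hi (h.1 h')
        simp [hi, this]
    · rw [not_and_or, Finset.not_subset, Finset.not_subset] at h
      rcases h with ⟨i, hi, hiD⟩ | ⟨i, hi, hiD⟩
      · exact nestedPower_eq_zero a (hL hi) (by simp [hi, hiD])
      · exact nestedPower_eq_zero a (hD hi) (by simp [hi, hiD])
  · intro i hi
    by_cases h1 : i ∈ L
    · simp [h1, hLH h1, hTL i h1]
    · by_cases h2 : i ∈ H
      · simp [h1, h2, hT i hi h1 h2]
      · simp [h1, h2, hTH i hi h2]

/-! ### Iterated projections as powers with operators inserted -/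

/-- The list form of `iter_blocks`: `P_q` is inserted at the partial sums of `L`, and a last part
`p + 1` multiplies from the right. -/
theorem iter_replicate_mul (P : RotaBaxter K A) (a : A) (q : Bool) {T : ℕ → A →ₗ[K] A}
    (L : List ℕ) (hL : ∀ i ∈ L, 0 < i) (p : ℕ)
    (hT : ∀ j, 0 < j → j ≤ L.length → T (L.take j).sum = P.proj q)
    (hT' : ∀ i, 0 < i → i < L.sum + p + 1 → (∀ j ≤ L.length, i ≠ (L.take j).sum) →
      T i = LinearMap.id) :
    P.iter a L (List.replicate L.length q) * a ^ (p + 1) = nestedPower a T (L.sum + p) := by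
  induction L using List.reverseRecOn generalizing p with
  | nil =>
    rw [List.sum_nil, nestedPower_add a 0 p]
    · simp [iter, nestedPower, pow_succ']
    · intro i h0 h1
      refine hT' i h0 (by simpa using h1) fun j _ => ?_
      simp only [List.take_nil, List.sum_nil]
      omega
  | append_singleton L r ih =>
    have hr : 0 < r := hL r (by simp)
    obtain ⟨r, rfl⟩ : ∃ r', r = r' + 1 := ⟨r - 1, by omega⟩
    have htake : ∀ j ≤ L.length, (L ++ [r + 1]).take j = L.take j := fun j hj =>
      List.take_append_of_le_length hj
    have htake' : ∀ j ≤ L.length, (L.take j).sum ≤ L.sum := fun j hj => by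
      conv_rhs => rw [← List.take_append_drop j L, List.sum_append]
      omega
    rw [List.length_append, List.length_singleton, List.replicate_succ',
      iter_append_singleton _ _ (by simp), ih (fun i hi => hL i (by simp [hi])),
      List.sum_append, List.sum_singleton, nestedPower_add a (L.sum + (r + 1)) p, ← Nat.add_assoc,
      nestedPower,
      mul_assoc, ← pow_succ']
    · congr 2
      have := hT (L.length + 1) (by omega) (by simp)
      rw [← this, List.take_of_length_le (by simp)]
      simp [Nat.add_assoc]
    · intro i h1 h2
      refine hT' i (by omega) (by simpa using h2) fun j hj => ?_
      rw [List.length_append, List.length_singleton] at hj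
      rcases Nat.lt_or_ge L.length j with hj' | hj'
      · rw [List.take_of_length_le (by simp; omega), List.sum_append, List.sum_singleton]
        omega
      · have := htake' j hj'
        rw [htake j hj']
        omega
    · intro j h0 hj
      rw [← hT j h0 (by simp; omega), htake j hj]
    · intro i h0 h1 h2
      refine hT' i h0 (by simp; omega) fun j hj => ?_
      rw [List.length_append, List.length_singleton] at hj
      rcases Nat.lt_or_ge L.length j with hj' | hj'
      · rw [List.take_of_length_le (by simp; omega), List.sum_append, List.sum_singleton]
        omega
      · rw [htake j hj']
        exact h2 j hj'

/-- `P^I_ε(a)` for `ε = (q, …, q, s)`: the power of `a` with `P_q` inserted at the descents of `I`,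
followed by `P_s`. -/
theorem iter_blocks (P : RotaBaxter K A) (a : A) (q s : Bool) {m : ℕ} (I : Composition (m + 1)) :
    P.iter a I.blocks (List.replicate (I.length - 1) q ++ [s]) =
      P.proj s (nestedPower a
        ((descents I).piecewise (fun _ => P.proj q) fun _ => LinearMap.id) m) := by
  rcases List.eq_nil_or_concat' I.blocks with h | ⟨L, p, h⟩
  · exact absurd ((I.blocks_eq_nil).1 h) (by omega)
  have hpos : ∀ {i}, i ∈ L ++ [p] → 0 < i := fun {i} hi => I.blocks_pos (h ▸ hi)
  have hp : 0 < p := hpos (by simp)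
  obtain ⟨p, rfl⟩ : ∃ p', p = p' + 1 := ⟨p - 1, by omega⟩
  have hlen : I.length = L.length + 1 := by rw [← I.blocks_length, h]; simp
  have hsum : m = L.sum + p := by
    have := I.blocks_sum
    rw [h, List.sum_append, List.sum_singleton] at this
    omega
  subst hsum
  have hsize : ∀ j ≤ L.length, I.sizeUpTo j = (L.take j).sum := fun j hj => by
    rw [Composition.sizeUpTo, h, List.take_append_of_le_length hj]
  rw [h, hlen, Nat.add_sub_cancel, iter_append_singleton _ _ (by simp),
    iter_replicate_mul P a q L fun i hi => hpos (List.mem_append_left _ hi)]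
  · intro j h0 hj
    refine Finset.piecewise_eq_of_mem _ _ _ ?_
    rw [← hsize j hj]
    exact Finset.mem_image_of_mem _ (Finset.mem_Ioo.2 ⟨h0, by omega⟩)
  · intro i h0 h1 h2
    refine Finset.piecewise_eq_of_notMem _ _ _ fun hi => ?_
    obtain ⟨j, hj, rfl⟩ := Finset.mem_image.1 hi
    have hj := Finset.mem_Ioo.1 hj
    exact h2 j (by omega) (hsize j (by omega))

theorem iter_ones_mul (P : RotaBaxter K A) (a : A) {T : ℕ → A →ₗ[K] A} (m : ℕ) (ε : Fin m → Bool)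
    (hT : ∀ i : Fin m, T (i + 1) = P.proj (ε i)) :
    P.iter a (List.replicate m 1) (List.ofFn ε) * a = nestedPower a T m := by
  induction m with
  | zero => simp [iter, nestedPower]
  | succ m ih =>
    rw [List.ofFn_succ', List.concat_eq_append, List.replicate_succ',
      iter_append_singleton _ _ (by simp), pow_one, ih _ fun i => hT i.castSucc, nestedPower,
      ← hT (Fin.last m), Fin.val_last]

/-- `P_{ε,s}(a)`: the power of `a` with `P₋` inserted at the descents of the composition encoded by
`ε` and `P₊` at all other places, followed by `P_s`. -/
theorem iter_ones (P : RotaBaxter K A) (a : A) (s : Bool) {m : ℕ} (ε : Fin m → Bool) :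
    P.iter a (List.replicate (m + 1) 1) (List.ofFn ε ++ [s]) =
      P.proj s (nestedPower a ((descents (compOfSigns ε)).piecewise
        (fun _ => P.proj false) fun _ => P.proj true) m) := by
  rw [List.replicate_succ', iter_append_singleton _ _ (by simp), pow_one, iter_ones_mul]
  intro i
  have := mem_descents_compOfSigns ε i
  cases h : ε i <;> simp_all

theorem proj_false_eq (P : RotaBaxter K A) : P.proj false = LinearMap.id - P.proj true := rfl

/-- Expanding `id = P₊ + P₋` at the places that are not descents of `I`. -/
theorem iter_blocks_false_eq_sum_iter_ones (P : RotaBaxter K A) (a : A) (s : Bool) {m : ℕ}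
    (I : Composition (m + 1)) :
    P.iter a I.blocks (List.replicate (I.length - 1) false ++ [s]) =
      ∑ ε : Fin m → Bool, if descents I ⊆ descents (compOfSigns ε) then
        P.iter a (List.replicate (m + 1) 1) (List.ofFn ε ++ [s]) else 0 := by
  simp_rw [iter_blocks, iter_ones]
  rw [sum_compOfSigns m fun J => if descents I ⊆ descents J then P.proj s (nestedPower a
      ((descents J).piecewise (fun _ => P.proj false) fun _ => P.proj true) m) else 0,
    sum_composition_eq_sum_powerset m fun D => if descents I ⊆ D then P.proj s (nestedPower a
      (D.piecewise (fun _ => P.proj false) fun _ => P.proj true) m) else 0,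
    nestedPower_eq_sum_between a (fun _ => P.proj false) (fun _ => P.proj true) m
      (descents_subset I) (descents_subset I), map_sum]
  · refine Finset.sum_congr rfl fun D hD => ?_
    have hD := Finset.mem_powerset.1 hD
    simp [hD, apply_ite (P.proj s)]
  · exact fun i hi => Finset.piecewise_eq_of_mem _ _ _ hi
  · exact fun i hi hi' => absurd hi hi'
  · intro i _ hi _
    simp [hi, proj_false_eq]

theorem neg_one_pow_smul (n : ℕ) (u : A) : (-1 : K) ^ n • u = (-1) ^ n * u := by
  rcases neg_one_pow_eq_or K n with h | h <;> rcases Nat.even_or_odd n with h' | h' <;>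
    simp [h'.neg_one_pow]

theorem map_neg_one_pow_mul (f : A →ₗ[K] A) (n : ℕ) (u : A) :
    f ((-1) ^ n * u) = (-1) ^ n * f u := by
  rw [← neg_one_pow_smul (K := K), map_smul, neg_one_pow_smul]

/-- Expanding `P₋ = id - P₊` at the descents of `I`: the identity merges adjacent parts of `I`. -/
theorem iter_blocks_false_eq_sum_iter_blocks_true (P : RotaBaxter K A) (a : A) (s : Bool) {m : ℕ}
    (I : Composition (m + 1)) :
    P.iter a I.blocks (List.replicate (I.length - 1) false ++ [s]) =
      ∑ J : Composition (m + 1) with descents J ⊆ descents I,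
        (-1) ^ (J.length - 1) * P.iter a J.blocks (List.replicate (J.length - 1) true ++ [s]) := by
  simp_rw [iter_blocks, ← card_descents]
  rw [Finset.sum_filter,
    sum_composition_eq_sum_powerset m fun D => if D ⊆ descents I then
      (-1) ^ D.card * P.proj s (nestedPower a
        (D.piecewise (fun _ => P.proj true) fun _ => LinearMap.id) m) else 0,
    nestedPower_eq_sum_between a (fun _ => -P.proj true) (fun _ => LinearMap.id) m
      (Finset.empty_subset (descents I)) (Finset.empty_subset _), map_sum]
  · refine Finset.sum_congr rfl fun D hD => ?_
    have hD := Finset.mem_powerset.1 hD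
    simp only [Finset.empty_subset, true_and, apply_ite (P.proj s), map_zero]
    congr 1
    rw [← map_neg_one_pow_mul, ← neg_one_pow_smul (K := K)]
    have hprod : ∏ i ∈ Finset.Ioo 0 (m + 1), D.piecewise (fun _ => -1) (fun _ => (1 : K)) i =
        (-1) ^ D.card := by
      simp [Finset.prod_piecewise, Finset.inter_eq_right.2 hD]
    rw [← hprod, ← nestedPower_smul]
    congr 2
    funext i
    by_cases hi : i ∈ D
    · simp only [hi, Finset.piecewise_eq_of_mem]
      exact (neg_one_smul K _).symm
    · simp [hi]
  · simp
  · intro i _ hi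
    simp [hi]
  · intro i _ _ hi
    simp [hi, proj_false_eq, sub_eq_neg_add]

/-- Expanding `P₋ = id - P₊` at the signs `-` of `ε`: what is left are the compositions with a
descent at least wherever `ε` has the sign `+`. -/
theorem iter_ones_eq_sum_iter_blocks_true (P : RotaBaxter K A) (a : A) (s : Bool) {m : ℕ}
    (ε : Fin m → Bool) :
    (-1) ^ ((compOfSigns ε).length - 1) *
        P.iter a (List.replicate (m + 1) 1) (List.ofFn ε ++ [s]) =
      ∑ J : Composition (m + 1) with descents (conjMirror ε) ⊆ descents J,
        (-1) ^ (m - (J.length - 1)) *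
          P.iter a J.blocks (List.replicate (J.length - 1) true ++ [s]) := by
  simp_rw [iter_blocks, iter_ones, ← card_descents]
  set E := descents (compOfSigns ε)
  have hEm : E ⊆ Finset.Ioo 0 (m + 1) := descents_subset _
  have hprodE : ∏ i ∈ Finset.Ioo 0 (m + 1), E.piecewise (fun _ => -1) (fun _ => (1 : K)) i =
      (-1) ^ E.card := by
    simp [Finset.prod_piecewise, Finset.inter_eq_right.2 hEm]
  -- the sign turns the inserted `P₋` into `-P₋ = P₊ - id`
  rw [Finset.sum_filter,
    sum_composition_eq_sum_powerset m fun D => if descents (conjMirror ε) ⊆ D then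
      (-1) ^ (m - D.card) * P.proj s (nestedPower a
        (D.piecewise (fun _ => P.proj true) fun _ => LinearMap.id) m) else 0,
    ← map_neg_one_pow_mul, ← neg_one_pow_smul (K := K), ← hprodE, ← nestedPower_smul,
    nestedPower_eq_sum_between a (fun _ => P.proj true) (fun _ => -LinearMap.id) m
      (descents_subset (conjMirror ε)) (descents_subset _), map_sum]
  · refine Finset.sum_congr rfl fun D hD => ?_
    have hD := Finset.mem_powerset.1 hD
    simp only [hD, and_true, apply_ite (P.proj s), map_zero]
    congr 1
    rw [← map_neg_one_pow_mul, ← neg_one_pow_smul (K := K)]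
    have hprod : ∏ i ∈ Finset.Ioo 0 (m + 1), D.piecewise (fun _ => 1) (fun _ => (-1 : K)) i =
        (-1) ^ (m - D.card) := by
      simp [Finset.prod_piecewise, Finset.card_sdiff_of_subset hD]
    rw [← hprod, ← nestedPower_smul]
    congr 2
    funext i
    by_cases hi : i ∈ D
    · simp [hi]
    · simp only [hi, not_false_eq_true, Finset.piecewise_eq_of_notMem]
      exact (neg_one_smul K _).symm
  · intro i hi
    rw [descents_conjMirror, Finset.mem_sdiff] at hi
    simp [E, hi.2]
  · exact fun i hi hi' => absurd hi hi'
  · intro i hi hi' _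
    rw [descents_conjMirror, Finset.mem_sdiff, not_and_not_right] at hi'
    simp [E, hi' hi, proj_false_eq, sub_eq_add_neg, add_comm]

end RotaBaxter

/-! ### The Birkhoff factorisation of `σ_a` -/

namespace RotaBaxter

variable {K A : Type*} [CommRing K] [Ring A] [Algebra K A]

theorem projSym_tmul (P : RotaBaxter K A) (s : Bool) (u : A) (x : NSym K) :
    P.projSym s (u ⊗ₜ[K] x) = P.proj s u ⊗ₜ[K] x := by
  rw [projSym, LinearMap.rTensor_tmul]

theorem projSym_add (P : RotaBaxter K A) (x : A ⊗[K] NSym K) :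
    P.projSym true x + P.projSym false x = x := by
  rw [← LinearMap.add_apply, projSym, projSym, ← LinearMap.rTensor_add, proj_false_eq,
    add_sub_cancel, LinearMap.rTensor_id, LinearMap.id_apply]

theorem coeff_mul_of_coeff_zero_right (f g : PowerSeries (A ⊗[K] NSym K)) (hg : g.coeff 0 = 1)
    (n : ℕ) :
    (f * g).coeff n = (∑ k : Fin n, f.coeff k * g.coeff (n - k)) + f.coeff n := by
  rw [PowerSeries.coeff_mul,
    Finset.Nat.sum_antidiagonal_eq_sum_range_succ (fun i j => f.coeff i * g.coeff j),
    Finset.sum_range_succ, Nat.sub_self, hg, mul_one,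
    Fin.sum_univ_eq_sum_range (fun k => f.coeff k * g.coeff (n - k))]

theorem coeff_sigma (a : A) (n : ℕ) : (sigma K a).coeff n = (a ^ n) ⊗ₜ[K] NSym.S K n :=
  PowerSeries.coeff_mk _ _

theorem coeff_zero_sigma (a : A) : (sigma K a).coeff 0 = 1 := by
  rw [coeff_sigma]
  simp [NSym.S, Algebra.TensorProduct.one_def]

theorem coeff_zero_sigmaMinus (P : RotaBaxter K A) (a : A) : (P.sigmaMinus a).coeff 0 = 1 := by
  rw [sigmaMinus, PowerSeries.coeff_mk, birkhoffMinusCoeff]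

theorem coeff_zero_sigmaPlus (P : RotaBaxter K A) (a : A) : (P.sigmaPlus a).coeff 0 = 1 := by
  rw [sigmaPlus, PowerSeries.coeff_mk, birkhoffPlusCoeff]

theorem coeff_succ_sigmaMinus (P : RotaBaxter K A) (a : A) (n : ℕ) :
    (P.sigmaMinus a).coeff (n + 1) = -P.projSym false (∑ k : Fin (n + 1),
      (P.sigmaMinus a).coeff k * (sigma K a).coeff (n + 1 - k)) := by
  simp_rw [sigmaMinus, PowerSeries.coeff_mk]
  rw [birkhoffMinusCoeff]

theorem coeff_succ_sigmaPlus (P : RotaBaxter K A) (a : A) (n : ℕ) :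
    (P.sigmaPlus a).coeff (n + 1) = P.projSym true (∑ k : Fin (n + 1),
      (P.sigmaMinus a).coeff k * (sigma K a).coeff (n + 1 - k)) := by
  simp_rw [sigmaPlus, sigmaMinus, PowerSeries.coeff_mk]
  rw [birkhoffPlusCoeff]

theorem sigmaPlus_eq_mul (P : RotaBaxter K A) (a : A) :
    P.sigmaPlus a = P.sigmaMinus a * sigma K a := by
  ext n
  rw [coeff_mul_of_coeff_zero_right _ _ (coeff_zero_sigma a)]
  cases n with
  | zero => simp [coeff_zero_sigmaPlus, coeff_zero_sigmaMinus]
  | succ n =>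
    rw [coeff_succ_sigmaMinus, coeff_succ_sigmaPlus, ← sub_eq_add_neg, eq_sub_iff_add_eq,
      projSym_add]

theorem isBirkhoffFactorization_sigma (P : RotaBaxter K A) (a : A) :
    P.IsBirkhoffFactorization a (P.sigmaPlus a) (P.sigmaMinus a) where
  factor := P.sigmaPlus_eq_mul a
  coeff_zero_plus := P.coeff_zero_sigmaPlus a
  coeff_zero_minus := P.coeff_zero_sigmaMinus a
  coeff_plus n hn := by
    obtain ⟨n, rfl⟩ : ∃ k, n = k + 1 := ⟨n - 1, by omega⟩
    rw [coeff_succ_sigmaPlus]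
    exact LinearMap.mem_range_self _ _
  coeff_minus n hn := by
    obtain ⟨n, rfl⟩ : ∃ k, n = k + 1 := ⟨n - 1, by omega⟩
    rw [coeff_succ_sigmaMinus, ← map_neg]
    exact LinearMap.mem_range_self _ _

theorem IsBirkhoffFactorization.unique (P : RotaBaxter K A) (a : A)
    (hP : ∀ u, P.plus (P.plus u) = P.plus u) {f g : PowerSeries (A ⊗[K] NSym K)}
    (h : P.IsBirkhoffFactorization a f g) : f = P.sigmaPlus a ∧ g = P.sigmaMinus a := by
  have hplus : ∀ x, P.projSym true (P.projSym true x) = P.projSym true x := fun x => by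
    have : P.plus ∘ₗ P.plus = P.plus := LinearMap.ext hP
    rw [← LinearMap.comp_apply, projSym, ← LinearMap.rTensor_comp, proj, this]
  have hminus : ∀ x, P.projSym true (P.projSym false x) = 0 := fun x => by
    conv_lhs => rw [eq_sub_of_add_eq' (P.projSym_add x), map_sub, hplus, sub_self]
  have hg : ∀ n, g.coeff n = (P.sigmaMinus a).coeff n := by
    intro n
    induction n using Nat.strong_induction_on with
    | _ n ih =>
      cases n with
      | zero => rw [h.coeff_zero_minus, coeff_zero_sigmaMinus]
      | succ n =>
        set x := ∑ k : Fin (n + 1), g.coeff k * (sigma K a).coeff (n + 1 - k)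
        have h1 : f.coeff (n + 1) = x + g.coeff (n + 1) := by
          rw [h.factor, coeff_mul_of_coeff_zero_right _ _ (coeff_zero_sigma a)]
        obtain ⟨y, hy⟩ := h.coeff_plus (n + 1) n.succ_pos
        obtain ⟨z, hz⟩ := h.coeff_minus (n + 1) n.succ_pos
        -- `P₊` fixes the coefficient of `f` and kills that of `g`
        have h2 : f.coeff (n + 1) = P.projSym true x := by
          rw [← hy, ← hplus, hy, h1, map_add, ← hz, hminus, add_zero]
        have h3 : x = ∑ k : Fin (n + 1), (P.sigmaMinus a).coeff k *
            (sigma K a).coeff (n + 1 - k) :=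
          Finset.sum_congr rfl fun k _ => by rw [ih k k.2]
        rw [coeff_succ_sigmaMinus, ← h3, eq_neg_iff_add_eq_zero, eq_sub_of_add_eq' h1.symm, h2,
          sub_add_eq_add_sub, P.projSym_add, sub_self]
  obtain rfl : g = P.sigmaMinus a := PowerSeries.ext hg
  exact ⟨by rw [h.factor, sigmaPlus_eq_mul], rfl⟩

/-! ### Solving the recurrence -/

/-- The solution of a recurrence of Birkhoff type for `∑ aⁿ G_n`: a term `(-1)^l P_s(⋯ P_s(a^{i₁})
⋯ a^{i_l}) ⊗ G_{i₁} ⋯ G_{i_l}` for each composition. -/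
theorem eq_sum_of_recurrence (P : RotaBaxter K A) (a : A) (s : Bool) (G : ℕ → NSym K)
    (c : ℕ → A ⊗[K] NSym K) (hc0 : c 0 = 1)
    (hc : ∀ n, c (n + 1) = -P.projSym s (∑ k : Fin (n + 1),
      c k * (a ^ (n + 1 - (k : ℕ))) ⊗ₜ[K] G (n + 1 - k))) (n : ℕ) :
    c n = ∑ I : Composition n, ((-1) ^ I.length * P.iter a I.blocks (List.replicate I.length s))
      ⊗ₜ[K] (I.blocks.map G).prod ∧
    ∀ t, P.projSym t (∑ k : Fin (n + 1), c k * (a ^ (n + 1 - (k : ℕ))) ⊗ₜ[K] G (n + 1 - k)) =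
      ∑ I : Composition (n + 1), ((-1) ^ (I.length - 1) *
        P.iter a I.blocks (List.replicate (I.length - 1) s ++ [t])) ⊗ₜ[K]
          (I.blocks.map G).prod := by
  have key : ∀ n, (∀ k < n + 1, c k = ∑ I : Composition k,
      ((-1) ^ I.length * P.iter a I.blocks (List.replicate I.length s))
        ⊗ₜ[K] (I.blocks.map G).prod) →
      ∀ t, P.projSym t (∑ k : Fin (n + 1), c k * (a ^ (n + 1 - (k : ℕ))) ⊗ₜ[K] G (n + 1 - k)) =
      ∑ I : Composition (n + 1), ((-1) ^ (I.length - 1) *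
        P.iter a I.blocks (List.replicate (I.length - 1) s ++ [t])) ⊗ₜ[K]
          (I.blocks.map G).prod := by
    intro n ih t
    rw [sum_composition_succ n fun L => ((-1) ^ (L.length - 1) *
        P.iter a L (List.replicate (L.length - 1) s ++ [t])) ⊗ₜ[K] (L.map G).prod, map_sum]
    refine Finset.sum_congr rfl fun k _ => ?_
    rw [ih k k.2, Finset.sum_mul, map_sum]
    refine Finset.sum_congr rfl fun J _ => ?_
    rw [Algebra.TensorProduct.tmul_mul_tmul, projSym_tmul, mul_assoc, map_neg_one_pow_mul,
      List.length_append, List.length_singleton, Nat.add_sub_cancel,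
      iter_append_singleton _ _ (by simp), List.map_append, List.prod_append, List.map_singleton,
      List.prod_singleton]
  have main : ∀ n, c n = ∑ I : Composition n,
      ((-1) ^ I.length * P.iter a I.blocks (List.replicate I.length s))
        ⊗ₜ[K] (I.blocks.map G).prod := by
    intro n
    induction n using Nat.strong_induction_on with
    | _ n ih =>
      cases n with
      | zero =>
        have h : ∀ I : Composition 0, I.blocks = [] := fun I => I.blocks_eq_nil.2 rfl
        have : Subsingleton (Composition 0) := ⟨fun I J => Composition.ext (by rw [h, h])⟩
        rw [hc0, Fintype.sum_subsingleton _ (Composition.ones 0)]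
        simp [Composition.length, h, iter, Algebra.TensorProduct.one_def]
      | succ n =>
        rw [hc, key n ih, ← Finset.sum_neg_distrib]
        refine Finset.sum_congr rfl fun I _ => ?_
        obtain ⟨l, hl⟩ : ∃ l, I.length = l + 1 :=
          ⟨I.length - 1, by have := I.length_pos_iff.2 n.succ_pos; omega⟩
        rw [← TensorProduct.neg_tmul, hl, Nat.add_sub_cancel, ← List.replicate_succ', pow_succ,
          mul_neg_one, neg_mul]
  exact ⟨main n, key n fun k _ => main k⟩

theorem coeff_sigmaMinus_eq_sum_SProd (P : RotaBaxter K A) (a : A) (n : ℕ) :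
    (P.sigmaMinus a).coeff n = ∑ I : Composition n,
      ((-1) ^ I.length * P.iter a I.blocks (List.replicate I.length false))
        ⊗ₜ[K] NSym.SProd K I :=
  (P.eq_sum_of_recurrence a false (NSym.S K) (fun n => (P.sigmaMinus a).coeff n)
    (P.coeff_zero_sigmaMinus a) (fun n => by
    simp_rw [coeff_succ_sigmaMinus, coeff_sigma]) n).1

theorem coeff_succ_sigmaPlus_eq_sum_SProd (P : RotaBaxter K A) (a : A) (n : ℕ) :
    (P.sigmaPlus a).coeff (n + 1) = ∑ I : Composition (n + 1),
      ((-1) ^ (I.length - 1) * P.iter a I.blocks (List.replicate (I.length - 1) false ++ [true]))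
        ⊗ₜ[K] NSym.SProd K I := by
  simp_rw [coeff_succ_sigmaPlus, coeff_sigma]
  exact (P.eq_sum_of_recurrence a false (NSym.S K) (fun n => (P.sigmaMinus a).coeff n)
    (P.coeff_zero_sigmaMinus a) (fun n => by
    simp_rw [coeff_succ_sigmaMinus, coeff_sigma]) n).2 true

/-! ### The expansion on products of elementary functions -/

/-- The series `∑ (-a)ⁿ Λ_n`, the inverse of `σ_a`. -/
noncomputable def lambdaNeg (K : Type*) {A : Type*} [CommRing K] [Ring A] [Algebra K A] (a : A) :
    PowerSeries (A ⊗[K] NSym K) :=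
  PowerSeries.mk fun n => (a ^ n) ⊗ₜ[K] ((-1) ^ n * NSym.Lam K n)

theorem coeff_lambdaNeg (a : A) (n : ℕ) :
    (lambdaNeg K a).coeff n = (a ^ n) ⊗ₜ[K] ((-1) ^ n * NSym.Lam K n) :=
  PowerSeries.coeff_mk _ _

theorem coeff_zero_lambdaNeg (a : A) : (lambdaNeg K a).coeff 0 = 1 := by
  rw [coeff_lambdaNeg]
  simp [NSym.Lam, Algebra.TensorProduct.one_def]

theorem lambdaNeg_mul_sigma (a : A) : lambdaNeg K a * sigma K a = 1 := by
  ext n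
  rw [coeff_mul_of_coeff_zero_right _ _ (coeff_zero_sigma a)]
  cases n with
  | zero => simp [coeff_zero_lambdaNeg]
  | succ n =>
    have h : ∀ k : Fin (n + 1), (lambdaNeg K a).coeff k * (sigma K a).coeff (n + 1 - k) =
        (a ^ (n + 1)) ⊗ₜ[K] ((-1) ^ (k : ℕ) * NSym.Lam K k * NSym.S K (n + 1 - k)) := by
      intro k
      rw [coeff_lambdaNeg, coeff_sigma, Algebra.TensorProduct.tmul_mul_tmul, ← pow_add,
        show (k : ℕ) + (n + 1 - k) = n + 1 by omega]
    rw [PowerSeries.coeff_one, if_neg n.succ_ne_zero, Finset.sum_congr rfl fun k _ => h k,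
      coeff_lambdaNeg, ← TensorProduct.tmul_sum, ← TensorProduct.tmul_add, NSym.Lam,
      Finset.mul_sum, ← Finset.sum_add_distrib, Finset.sum_eq_zero, TensorProduct.tmul_zero]
    intro k _
    rw [← mul_assoc, ← mul_assoc, ← pow_add,
      show n + 1 + (n - (k : ℕ)) = k + (2 * (n - k) + 1) by omega, pow_add, pow_succ, pow_mul]
    simp

theorem sigma_mul_lambdaNeg (a : A) : sigma K a * lambdaNeg K a = 1 := by
  have h := PowerSeries.mul_invOfUnit (sigma K a) 1 (by
    rw [← PowerSeries.coeff_zero_eq_constantCoeff_apply, coeff_zero_sigma, Units.val_one])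
  rwa [← left_inv_eq_right_inv (lambdaNeg_mul_sigma a) h] at h

/-- As `σ⁻ = σ⁺ ∑ (-a)ⁿ Λ_n`, the sum in the Birkhoff recurrence can be taken over products of
`σ⁺` with the inverse of `σ_a` instead. -/
theorem sum_sigmaPlus_mul_lambdaNeg (P : RotaBaxter K A) (a : A) (n : ℕ) :
    ∑ k : Fin (n + 1), (P.sigmaPlus a).coeff k * (lambdaNeg K a).coeff (n + 1 - k) =
      -∑ k : Fin (n + 1), (P.sigmaMinus a).coeff k * (sigma K a).coeff (n + 1 - k) := by
  have h1 := coeff_mul_of_coeff_zero_right (P.sigmaPlus a) _ (coeff_zero_lambdaNeg (K := K) a)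
    (n + 1)
  have h2 := coeff_mul_of_coeff_zero_right (P.sigmaMinus a) _ (coeff_zero_sigma (K := K) a) (n + 1)
  rw [sigmaPlus_eq_mul, mul_assoc, sigma_mul_lambdaNeg, mul_one, ← sigmaPlus_eq_mul] at h1
  rw [← sigmaPlus_eq_mul] at h2
  rw [eq_neg_iff_add_eq_zero, eq_sub_of_add_eq h1.symm, eq_sub_of_add_eq h2.symm]
  abel

theorem prod_map_neg_one_pow_mul_Lam (L : List ℕ) :
    (L.map fun n => (-1) ^ n * NSym.Lam K n).prod =
      (-1) ^ L.sum * (L.map (NSym.Lam K)).prod := by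
  induction L with
  | nil => simp
  | cons p L ih =>
    rw [List.map_cons, List.prod_cons, ih, List.sum_cons, List.map_cons, List.prod_cons, pow_add,
      mul_assoc, mul_assoc, ← mul_assoc (NSym.Lam K p),
      ((Commute.neg_one_right (NSym.Lam K p)).pow_right L.sum).eq, mul_assoc]

theorem neg_one_pow_mul_tmul (i n : ℕ) (u : A) (x : NSym K) :
    ((-1) ^ i * u) ⊗ₜ[K] ((-1) ^ n * x) = ((-1) ^ (n + i) * u) ⊗ₜ[K] x := by
  rw [← neg_one_pow_smul (K := K) n x, TensorProduct.tmul_smul, TensorProduct.smul_tmul',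
    neg_one_pow_smul, ← mul_assoc, ← pow_add]

/-- `σ⁺` satisfies a recurrence of its own, with `-P₊` and the inverse of `σ_a` in place of `-P₋`
and `σ_a`. -/
theorem coeff_succ_sigmaPlus_eq_neg (P : RotaBaxter K A) (a : A) (n : ℕ) :
    (P.sigmaPlus a).coeff (n + 1) = -P.projSym true (∑ k : Fin (n + 1),
      (P.sigmaPlus a).coeff k * (a ^ (n + 1 - (k : ℕ))) ⊗ₜ[K]
        ((-1) ^ (n + 1 - (k : ℕ)) * NSym.Lam K (n + 1 - k))) := by
  simp_rw [← coeff_lambdaNeg]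
  rw [sum_sigmaPlus_mul_lambdaNeg, map_neg, neg_neg, coeff_succ_sigmaPlus]

theorem coeff_sigmaPlus_eq_sum_LamProd (P : RotaBaxter K A) (a : A) (n : ℕ) :
    (P.sigmaPlus a).coeff n = ∑ I : Composition n,
      ((-1) ^ (n + I.length) * P.iter a I.blocks (List.replicate I.length true))
        ⊗ₜ[K] NSym.LamProd K I := by
  rw [(P.eq_sum_of_recurrence a true (fun n => (-1) ^ n * NSym.Lam K n)
    (fun n => (P.sigmaPlus a).coeff n) (P.coeff_zero_sigmaPlus a)
    (P.coeff_succ_sigmaPlus_eq_neg a) n).1]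
  refine Finset.sum_congr rfl fun I _ => ?_
  rw [prod_map_neg_one_pow_mul_Lam, I.blocks_sum, neg_one_pow_mul_tmul, NSym.LamProd]

theorem coeff_succ_sigmaMinus_eq_sum_LamProd (P : RotaBaxter K A) (a : A) (n : ℕ) :
    (P.sigmaMinus a).coeff (n + 1) = ∑ I : Composition (n + 1),
      ((-1) ^ (n + 1 + I.length - 1) *
        P.iter a I.blocks (List.replicate (I.length - 1) true ++ [false]))
        ⊗ₜ[K] NSym.LamProd K I := by
  have h := (P.eq_sum_of_recurrence a true (fun n => (-1) ^ n * NSym.Lam K n)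
    (fun n => (P.sigmaPlus a).coeff n) (P.coeff_zero_sigmaPlus a)
    (P.coeff_succ_sigmaPlus_eq_neg a) n).2 false
  simp_rw [← coeff_lambdaNeg] at h
  rw [sum_sigmaPlus_mul_lambdaNeg, map_neg, ← coeff_succ_sigmaMinus] at h
  rw [h]
  refine Finset.sum_congr rfl fun I _ => ?_
  have := I.length_pos_iff.2 n.succ_pos
  rw [prod_map_neg_one_pow_mul_Lam, I.blocks_sum, neg_one_pow_mul_tmul, NSym.LamProd,
    Nat.add_sub_assoc this]

/-! ### The expansion on ribbons -/

theorem length_le_of_descents_subset {n : ℕ} {I J : Composition n}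
    (h : descents J ⊆ descents I) : J.length ≤ I.length := by
  rcases Nat.eq_zero_or_pos n with rfl | hn
  · rw [J.length_eq_zero.2 rfl, I.length_eq_zero.2 rfl]
  · have h1 := Finset.card_le_card h
    rw [card_descents, card_descents] at h1
    have := I.length_pos_iff.2 hn
    omega

theorem signedRibbon_eq_sum {m : ℕ} (ε : Fin m → Bool) :
    NSym.signedRibbon K ε = ∑ J : Composition (m + 1) with
      descents J ⊆ descents (compOfSigns ε), (-1) ^ (J.length - 1) * NSym.SProd K J := by
  rw [NSym.signedRibbon, NSym.ribbon, Finset.mul_sum]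
  refine Finset.sum_congr rfl fun J hJ => ?_
  have h1 := length_le_of_descents_subset (Finset.mem_filter.1 hJ).2
  have h2 := J.length_pos_iff.2 m.succ_pos
  rw [← mul_assoc, ← pow_add,
    show (compOfSigns ε).length - 1 + ((compOfSigns ε).length - J.length) =
      2 * ((compOfSigns ε).length - J.length) + (J.length - 1) by omega, pow_add, pow_mul]
  simp

theorem sum_SProd_eq_sum_signedRibbon (P : RotaBaxter K A) (a : A) (s : Bool) (m : ℕ) :
    ∑ I : Composition (m + 1), ((-1) ^ (I.length - 1) *
        P.iter a I.blocks (List.replicate (I.length - 1) false ++ [s])) ⊗ₜ[K] NSym.SProd K I =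
      ∑ ε : Fin m → Bool, (P.iter a (List.replicate (m + 1) 1) (List.ofFn ε ++ [s]))
        ⊗ₜ[K] NSym.signedRibbon K ε := by
  simp_rw [signedRibbon_eq_sum, iter_blocks_false_eq_sum_iter_ones, TensorProduct.tmul_sum,
    Finset.mul_sum, TensorProduct.sum_tmul, Finset.sum_filter]
  rw [Finset.sum_comm]
  refine Finset.sum_congr rfl fun ε _ => Finset.sum_congr rfl fun J _ => ?_
  split_ifs
  · have h := neg_one_pow_mul_tmul (K := K) 0 (J.length - 1)
      (P.iter a (List.replicate (m + 1) 1) (List.ofFn ε ++ [s])) (NSym.SProd K J)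
    rw [pow_zero, one_mul, add_zero] at h
    exact h.symm
  · rw [mul_zero, TensorProduct.zero_tmul]

theorem coeff_succ_sigmaPlus_eq_sum_signedRibbon (P : RotaBaxter K A) (a : A) (m : ℕ) :
    (P.sigmaPlus a).coeff (m + 1) = ∑ ε : Fin m → Bool,
      (P.iter a (List.replicate (m + 1) 1) (List.ofFn ε ++ [true]))
        ⊗ₜ[K] NSym.signedRibbon K ε := by
  rw [coeff_succ_sigmaPlus_eq_sum_SProd, sum_SProd_eq_sum_signedRibbon]

theorem coeff_succ_sigmaMinus_eq_sum_signedRibbon (P : RotaBaxter K A) (a : A) (m : ℕ) :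
    (P.sigmaMinus a).coeff (m + 1) = -∑ ε : Fin m → Bool,
      (P.iter a (List.replicate (m + 1) 1) (List.ofFn ε ++ [false]))
        ⊗ₜ[K] NSym.signedRibbon K ε := by
  rw [← sum_SProd_eq_sum_signedRibbon, coeff_sigmaMinus_eq_sum_SProd, ← Finset.sum_neg_distrib]
  refine Finset.sum_congr rfl fun I _ => ?_
  obtain ⟨l, hl⟩ : ∃ l, I.length = l + 1 :=
    ⟨I.length - 1, by have := I.length_pos_iff.2 m.succ_pos; omega⟩
  rw [← TensorProduct.neg_tmul, hl, Nat.add_sub_cancel, ← List.replicate_succ', pow_succ,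
    mul_neg_one, neg_mul]

end RotaBaxter

/-! ### Sequences of polynomials -/

namespace PolySeq

variable (K : Type*) [CommRing K]

theorem x_mem_freeRotaBaxter : x K ∈ freeRotaBaxter K :=
  NonUnitalAlgebra.mem_sInf.2 fun _ hB => hB.1

theorem R_mem_freeRotaBaxter {z : PolySeq K} (hz : z ∈ freeRotaBaxter K) :
    R K z ∈ freeRotaBaxter K :=
  NonUnitalAlgebra.mem_sInf.2 fun B hB => hB.2 z (NonUnitalAlgebra.mem_sInf.1 hz B hB)

theorem proj_true_apply (z : PolySeq K) : (rotaBaxter K).proj true z = -R K z := rfl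

theorem proj_false_apply (z : PolySeq K) : (rotaBaxter K).proj false z = z + R K z :=
  sub_neg_eq_add _ _

theorem proj_mem_freeRotaBaxter (s : Bool) {z : PolySeq K} (hz : z ∈ freeRotaBaxter K) :
    (rotaBaxter K).proj s z ∈ freeRotaBaxter K := by
  cases s
  · rw [proj_false_apply]
    exact add_mem hz (R_mem_freeRotaBaxter K hz)
  · rw [proj_true_apply]
    exact neg_mem (R_mem_freeRotaBaxter K hz)

theorem x_pow_succ_mem_freeRotaBaxter (p : ℕ) : x K ^ (p + 1) ∈ freeRotaBaxter K := by
  induction p with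
  | zero => simpa using x_mem_freeRotaBaxter K
  | succ p ih =>
    rw [pow_succ]
    exact mul_mem ih (x_mem_freeRotaBaxter K)

theorem iter_mem_freeRotaBaxter (L : List ℕ) (hL : L ≠ []) (hpos : ∀ i ∈ L, 0 < i)
    (ε : List Bool) (hε : ε.length = L.length) :
    (rotaBaxter K).iter (x K) L ε ∈ freeRotaBaxter K := by
  induction L using List.reverseRecOn generalizing ε with
  | nil => exact absurd rfl hL
  | append_singleton L p ih =>
    rcases List.eq_nil_or_concat' ε with rfl | ⟨ε, s, rfl⟩
    · simp at hε
    have hlen : ε.length = L.length := by simpa using hε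
    obtain ⟨p, rfl⟩ : ∃ p', p = p' + 1 := ⟨p - 1, by have := hpos p (by simp); omega⟩
    rw [RotaBaxter.iter_append_singleton _ _ hlen.symm]
    apply proj_mem_freeRotaBaxter
    by_cases h : L = []
    · subst h
      have : ε = [] := List.eq_nil_of_length_eq_zero hlen
      simpa [RotaBaxter.iter] using x_pow_succ_mem_freeRotaBaxter K p
    · exact mul_mem (ih h (fun i hi => hpos i (by simp [hi])) ε hlen)
        (x_pow_succ_mem_freeRotaBaxter K p)

open Classical in
/-- The part of a monomial quasi-symmetric function where all indices are less than `t`, as an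
iterate of `P₊ = -R`: each application of `R` sums over the next index. -/
theorem sum_strictMono_lt (n r : ℕ) (e : Fin r → ℕ) (t : ℕ) (ht : t ≤ n) :
    ∑ j ∈ Finset.univ.filter fun j : Fin r → Fin n =>
        StrictMono j ∧ ∀ k, (j k : ℕ) < t,
      ∏ k, (MvPolynomial.X (j k : ℕ) : MvPolynomial ℕ K) ^ e k =
    ((-1) ^ r * (rotaBaxter K).iter (x K) (List.ofFn e) (List.replicate r true)) t := by
  induction r generalizing t with
  | zero =>
    rw [Finset.sum_filter, Fintype.sum_unique]
    simp [RotaBaxter.iter, Subsingleton.strictMono]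
  | succ r ih =>
    have hmono : ∀ (s : Fin n) (j : Fin r → Fin n),
        (StrictMono (Fin.snoc j s : Fin (r + 1) → Fin n) ∧
          ∀ k, ((Fin.snoc j s : Fin (r + 1) → Fin n) k : ℕ) < t) ↔
        (s : ℕ) < t ∧ StrictMono j ∧ ∀ k, (j k : ℕ) < s := by
      intro s j
      constructor
      · rintro ⟨h1, h2⟩
        refine ⟨by simpa using h2 (Fin.last r), fun k l hkl => ?_, fun k => ?_⟩
        · simpa using h1 (Fin.castSucc_lt_castSucc_iff.2 hkl)
        · simpa using h1 (Fin.castSucc_lt_last k)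
      · rintro ⟨h1, h2, h3⟩
        refine ⟨fun k l hkl => ?_, fun k => ?_⟩
        · induction l using Fin.lastCases with
          | last =>
            induction k using Fin.lastCases with
            | last => exact absurd hkl (lt_irrefl _)
            | cast k => simpa using h3 k
          | cast l =>
            induction k using Fin.lastCases with
            | last => exact absurd hkl (Fin.castSucc_lt_last l).not_gt
            | cast k => simpa using h2 (Fin.castSucc_lt_castSucc_iff.1 hkl)
        · induction k using Fin.lastCases with
          | last => simpa using h1
          | cast k => simpa using (h3 k).trans h1
    have hstep : ∀ s : Fin n,
        ∑ j : Fin r → Fin n, (if StrictMono (Fin.snoc j s : Fin (r + 1) → Fin n) ∧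
          ∀ k, ((Fin.snoc j s : Fin (r + 1) → Fin n) k : ℕ) < t then
          ∏ k, (MvPolynomial.X ((Fin.snoc j s : Fin (r + 1) → Fin n) k : ℕ) :
            MvPolynomial ℕ K) ^ e k else 0) =
        if (s : ℕ) < t then ((-1) ^ r * (rotaBaxter K).iter (x K)
          (List.ofFn fun k : Fin r => e k.castSucc) (List.replicate r true)) s *
            x K s ^ e (Fin.last r) else 0 := by
      intro s
      simp_rw [hmono, ← ih (fun k : Fin r => e k.castSucc) s s.2.le, Fin.prod_univ_castSucc,
        Fin.snoc_castSucc, Fin.snoc_last]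
      split_ifs with hs
      · rw [Finset.sum_filter, Finset.sum_mul]
        exact Finset.sum_congr rfl fun j _ => by simp [hs, ite_mul, x]
      · simp [hs]
    rw [Finset.sum_filter, ← (Fin.snocEquiv fun _ => Fin n).sum_comp, Fintype.sum_prod_type]
    refine (Finset.sum_congr rfl fun s _ => hstep s).trans ?_
    rw [Fin.sum_univ_eq_sum_range (fun s => if s < t then ((-1) ^ r * (rotaBaxter K).iter (x K)
      (List.ofFn fun k : Fin r => e k.castSucc) (List.replicate r true)) s *
        x K s ^ e (Fin.last r) else 0), ← Finset.sum_filter,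
      show (Finset.range n).filter (· < t) = Finset.range t by ext; simp; omega,
      List.ofFn_succ', List.concat_eq_append, List.replicate_succ',
      RotaBaxter.iter_append_singleton _ _ (by simp), proj_true_apply, pow_succ, mul_neg_one,
      neg_mul_neg, ← RotaBaxter.map_neg_one_pow_mul]
    simp [R, mul_assoc]

theorem monomialSeq_eq_iter {d : ℕ} (I : Composition d) :
    monomialSeq K I =
      (-1) ^ I.length * (rotaBaxter K).iter (x K) I.blocks (List.replicate I.length true) := by
  funext n
  have h := sum_strictMono_lt K n I.length I.blocksFun n le_rfl
  rw [I.ofFn_blocksFun] at h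
  rw [← h, monomialSeq]
  simp

theorem V_neg_one_pow_mul (l : ℕ) (z : PolySeq K) : V ((-1) ^ l * z) = (-1) ^ l * V z := by
  funext n
  simp [V]

theorem V_proj_true (z : PolySeq K) :
    V ((rotaBaxter K).proj true z) = -(rotaBaxter K).proj false z := by
  funext n
  rw [proj_true_apply, proj_false_apply]
  simp [V, R, Finset.sum_range_succ]
  ring

theorem V_iter_append_true {I : List ℕ} {ε : List Bool} (h : I.length = ε.length) (p : ℕ) :
    V ((rotaBaxter K).iter (x K) (I ++ [p]) (ε ++ [true])) =
      -(rotaBaxter K).iter (x K) (I ++ [p]) (ε ++ [false]) := by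
  rw [RotaBaxter.iter_append_singleton _ _ h, RotaBaxter.iter_append_singleton _ _ h, V_proj_true]

theorem neg_one_pow_mul_iter_eq_monomialNegSeq {m : ℕ} (I : Composition (m + 1)) :
    (-1) ^ (I.length - 1) * (rotaBaxter K).iter (x K) I.blocks
      (List.replicate (I.length - 1) false ++ [true]) = monomialNegSeq K I := by
  rw [RotaBaxter.iter_blocks_false_eq_sum_iter_blocks_true, monomialNegSeq]
  obtain ⟨l, hl⟩ : ∃ l, I.length = l + 1 :=
    ⟨I.length - 1, by have := I.length_pos_iff.2 m.succ_pos; omega⟩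
  rw [hl, Nat.add_sub_cancel, pow_succ, mul_assoc, neg_one_mul, ← Finset.sum_neg_distrib]
  congr 1
  refine Finset.sum_congr rfl fun J _ => ?_
  obtain ⟨l, hl⟩ : ∃ l, J.length = l + 1 :=
    ⟨J.length - 1, by have := J.length_pos_iff.2 m.succ_pos; omega⟩
  rw [monomialSeq_eq_iter, hl, Nat.add_sub_cancel, ← List.replicate_succ', pow_succ, mul_neg_one,
    neg_mul, neg_neg]

theorem neg_one_pow_mul_iter_eq_V_monomialNegSeq {m : ℕ} (I : Composition (m + 1)) :
    (-1) ^ I.length * (rotaBaxter K).iter (x K) I.blocks (List.replicate I.length false) =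
      V (monomialNegSeq K I) := by
  rw [← neg_one_pow_mul_iter_eq_monomialNegSeq, V_neg_one_pow_mul]
  rcases List.eq_nil_or_concat' I.blocks with h | ⟨L, p, h⟩
  · exact absurd ((I.blocks_eq_nil).1 h) (by omega)
  have hlen : I.length = L.length + 1 := by rw [← I.blocks_length, h]; simp
  rw [h, hlen, Nat.add_sub_cancel, V_iter_append_true K (by simp), List.replicate_succ', pow_succ,
    mul_neg_one, neg_mul, mul_neg]

theorem neg_one_pow_mul_iter_eq_fundamentalSeq {m : ℕ} (ε : Fin m → Bool) :
    (-1) ^ ((compOfSigns ε).length - 1) * (rotaBaxter K).iter (x K) (List.replicate (m + 1) 1)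
      (List.ofFn ε ++ [true]) = (-1) ^ (m + 1) * fundamentalSeq K (conjMirror ε) := by
  rw [RotaBaxter.iter_ones_eq_sum_iter_blocks_true, fundamentalSeq, Finset.mul_sum]
  refine Finset.sum_congr rfl fun J _ => ?_
  obtain ⟨l, hl⟩ : ∃ l, J.length = l + 1 :=
    ⟨J.length - 1, by have := J.length_pos_iff.2 m.succ_pos; omega⟩
  have hle := J.length_le
  rw [monomialSeq_eq_iter, hl, Nat.add_sub_cancel, ← List.replicate_succ', ← mul_assoc, ← pow_add,
    show m + 1 + (l + 1) = 2 * (l + 1) + (m - l) by omega, pow_add, pow_mul, neg_one_sq, one_pow,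
    one_mul]

theorem neg_one_pow_mul_iter_eq_V_fundamentalSeq {m : ℕ} (ε : Fin m → Bool) :
    -((-1) ^ ((compOfSigns ε).length - 1) * (rotaBaxter K).iter (x K) (List.replicate (m + 1) 1)
      (List.ofFn ε ++ [false])) = V ((-1) ^ (m + 1) * fundamentalSeq K (conjMirror ε)) := by
  rw [← neg_one_pow_mul_iter_eq_fundamentalSeq, V_neg_one_pow_mul, List.replicate_succ',
    V_iter_append_true K (by simp), mul_neg]

end PolySeq

theorem mainTheorem4 {K A : Type*} [CommRing K] [Ring A] [Algebra K A]
    (P : RotaBaxter K A) (a : A) :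
    -- the two series are a Birkhoff factorisation of `σ_a`, the only one if `A = A₊ ⊕ A₋`
    P.IsBirkhoffFactorization a (P.sigmaPlus a) (P.sigmaMinus a) ∧
    ((∀ u, P.plus (P.plus u) = P.plus u) → ∀ f g : PowerSeries (A ⊗[K] NSym K),
      P.IsBirkhoffFactorization a f g → f = P.sigmaPlus a ∧ g = P.sigmaMinus a) ∧
    -- expansions of `σ_a⁺` on the `S^I`, the `Λ^I` and the signed ribbons
    (∀ n, 0 < n → (P.sigmaPlus a).coeff n = ∑ I : Composition n,
      ((-1) ^ (I.length - 1) * P.iter a I.blocks (List.replicate (I.length - 1) false ++ [true]))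
        ⊗ₜ[K] NSym.SProd K I) ∧
    (∀ n, 0 < n → (P.sigmaPlus a).coeff n = ∑ I : Composition n,
      ((-1) ^ (n + I.length) * P.iter a I.blocks (List.replicate I.length true))
        ⊗ₜ[K] NSym.LamProd K I) ∧
    (∀ m, (P.sigmaPlus a).coeff (m + 1) = ∑ ε : Fin m → Bool,
      (P.iter a (List.replicate (m + 1) 1) (List.ofFn ε ++ [true]))
        ⊗ₜ[K] NSym.signedRibbon K ε) ∧
    -- expansions of `σ_a⁻` on the `S^I`, the `Λ^I` and the signed ribbons
    (∀ n, 0 < n → (P.sigmaMinus a).coeff n = ∑ I : Composition n,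
      ((-1) ^ I.length * P.iter a I.blocks (List.replicate I.length false))
        ⊗ₜ[K] NSym.SProd K I) ∧
    (∀ n, 0 < n → (P.sigmaMinus a).coeff n = ∑ I : Composition n,
      ((-1) ^ (n + I.length - 1) *
        P.iter a I.blocks (List.replicate (I.length - 1) true ++ [false]))
        ⊗ₜ[K] NSym.LamProd K I) ∧
    (∀ m, (P.sigmaMinus a).coeff (m + 1) = -∑ ε : Fin m → Bool,
      (P.iter a (List.replicate (m + 1) 1) (List.ofFn ε ++ [false]))
        ⊗ₜ[K] NSym.signedRibbon K ε) ∧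
    -- the iterated projections of the generator `x` lie in the free Rota-Baxter algebra, and there
    -- the coefficients of `S^I` and `R_I` in `σ_x^±` are as follows
    (∀ n, 0 < n → ∀ (I : Composition n) (ε : List Bool), ε.length = I.length →
      (PolySeq.rotaBaxter K).iter (PolySeq.x K) I.blocks ε ∈ PolySeq.freeRotaBaxter K) ∧
    (∀ n, 0 < n → ∀ I : Composition n,
      (-1) ^ (I.length - 1) * (PolySeq.rotaBaxter K).iter (PolySeq.x K) I.blocks
        (List.replicate (I.length - 1) false ++ [true]) = PolySeq.monomialNegSeq K I ∧
      (-1) ^ I.length * (PolySeq.rotaBaxter K).iter (PolySeq.x K) I.blocks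
        (List.replicate I.length false) = PolySeq.V (PolySeq.monomialNegSeq K I)) ∧
    (∀ (m : ℕ) (ε : Fin m → Bool),
      (-1) ^ ((compOfSigns ε).length - 1) * (PolySeq.rotaBaxter K).iter (PolySeq.x K)
        (List.replicate (m + 1) 1) (List.ofFn ε ++ [true]) =
          (-1) ^ (m + 1) * PolySeq.fundamentalSeq K (conjMirror ε) ∧
      -((-1) ^ ((compOfSigns ε).length - 1) * (PolySeq.rotaBaxter K).iter (PolySeq.x K)
        (List.replicate (m + 1) 1) (List.ofFn ε ++ [false])) =
          PolySeq.V ((-1) ^ (m + 1) * PolySeq.fundamentalSeq K (conjMirror ε))) := by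
  have hsucc : ∀ {p : ℕ → Prop}, (∀ n, p (n + 1)) → ∀ n, 0 < n → p n := fun h n hn =>
    Nat.succ_pred_eq_of_pos hn ▸ h _
  refine ⟨P.isBirkhoffFactorization_sigma a,
    fun hP f g h => RotaBaxter.IsBirkhoffFactorization.unique P a hP h,
    hsucc (P.coeff_succ_sigmaPlus_eq_sum_SProd a),
    fun n _ => P.coeff_sigmaPlus_eq_sum_LamProd a n,
    P.coeff_succ_sigmaPlus_eq_sum_signedRibbon a,
    fun n _ => P.coeff_sigmaMinus_eq_sum_SProd a n,
    hsucc (P.coeff_succ_sigmaMinus_eq_sum_LamProd a),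
    P.coeff_succ_sigmaMinus_eq_sum_signedRibbon a,
    fun n hn I ε hε => PolySeq.iter_mem_freeRotaBaxter K I.blocks
      (fun h => hn.ne' (I.blocks_eq_nil.1 h)) (fun i hi => I.blocks_pos hi) ε hε,
    hsucc fun n I => ⟨PolySeq.neg_one_pow_mul_iter_eq_monomialNegSeq K I,
      PolySeq.neg_one_pow_mul_iter_eq_V_monomialNegSeq K I⟩,
    fun m ε => ⟨PolySeq.neg_one_pow_mul_iter_eq_fundamentalSeq K ε,
      PolySeq.neg_one_pow_mul_iter_eq_V_fundamentalSeq K ε⟩⟩
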